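/- All graphs are finite and simple. Let $H$ be a graph and let $T$ be a tree with at least one edge. A graph is called $T$-free if it has no (not necessarily induced) subgraph isomorphic to $T$, and for $n \in \mathbb{N}$ let $\mathrm{Ex}(n,H,T)$ denote the maximum number of copies of $H$ (that is, subgraphs isomorphic to $H$) in a $T$-free graph on $n$ vertices. For $U \subseteq V(H)$ and a positive integer $t$, the $(U,t)$-blow-up of $H$ is the graph obtained by taking $t$ disjoint copies of $H$ and, for each $u \in U$, identifying the $t$ vertices that correspond to $u$. Suppose that $H$ is $T$-free. Then there is a subset $U \subseteq V(H)$ (for instance $U = V(H)$) for which the $(U,|V(T)|)$-blow-up of $H$ is $T$-free; let $r(H,T)$ be the maximum number of connected components of $H \setminus U$ over all such subsets $U$. Then, as $n \to \infty$, $$\mathrm{Ex}(n,H,T) = \Theta\bigl(n^{r(H,T)}\bigr),$$ where the implied constants depend only on $H$ and $T$. If $H$ is not $T$-free, then $\mathrm{Ex}(n,H,T) = 0$ for every $n$. -/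

import Mathlib

namespace GenTuran

/-- The `(U, t)`-blow-up of `H`: take `t` copies of `H` and, for each `u ∈ U`, identify the `t`
vertices that correspond to `u`. Its vertices are the vertices of `U` (once each), and pairs
`(w, i)` with `w ∉ U`, standing for the vertex `w` of the `i`-th copy. -/
def blowUp {V : Type*} (H : SimpleGraph V) (U : Set V) (t : ℕ) :
    SimpleGraph (↥U ⊕ (↥Uᶜ × Fin t)) where
  Adj
    | .inl u, .inl v => H.Adj u v
    | .inl u, .inr w => H.Adj u w.1
    | .inr w, .inl u => H.Adj w.1 u
    | .inr w, .inr x => w.2 = x.2 ∧ H.Adj w.1 x.1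
  symm := ⟨by
    rintro (u | ⟨w, i⟩) (v | ⟨x, j⟩) h
    · exact H.adj_symm h
    · exact H.adj_symm h
    · exact H.adj_symm h
    · exact ⟨h.1.symm, H.adj_symm h.2⟩⟩
  loopless := ⟨by
    rintro (u | ⟨w, i⟩) h
    · exact H.irrefl h
    · exact H.irrefl h.2⟩

open scoped Classical in
/-- `r(H, T)`: the maximum number of connected components of `H ∖ U`, over the subsets `U` of the
vertices of `H` for which the `(U, |T|)`-blow-up of `H` is `T`-free. (Such `U` exist if and only if
`H` is `T`-free; otherwise the value is the default `0`.) -/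
noncomputable def blowUpExponent {V W : Type*} [Fintype V] [Fintype W]
    (H : SimpleGraph V) (T : SimpleGraph W) : ℕ :=
  Finset.sup {U : Set V | T.Free (blowUp H U (Fintype.card W))}
    (fun U => Nat.card (H.induce Uᶜ).ConnectedComponent)

open scoped Classical in
/-- `Ex(n, H, F)`: the maximum number of copies of `H` (subgraphs isomorphic to `H`) in an `F`-free
graph on `n` vertices. -/
noncomputable def genExtremalNumber {V W : Type*} (n : ℕ)
    (H : SimpleGraph V) (F : SimpleGraph W) : ℕ :=
  Finset.sup {G : SimpleGraph (Fin n) | F.Free G} (fun G => G.copyCount H)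

end GenTuran

namespace GenTuran

open SimpleGraph Finset

/-! Lower bound: a copy of `T` meets at most `|T|` of the copies of `H` in a blow-up, so if the `(U,
|T|)`-blow-up is `T`-free, then so is the `(U, m)`-blow-up for every `m`. Choosing one of `m` copies
independently for each component of `H ∖ U` then gives `m ^ r` copies of `H` on `O(m)` vertices.

Upper bound: averaging over colourings of the host graph by vertices of `H` reduces to copies that
place each `v` on a vertex of colour `v`. Let `N` contain all sets on which two such copies can
differ. By `exists_stable_and_labelling` a family of copies is a stable one plus boundedly many
classes, each avoiding one difference set; induction on `#N` (`card_colored_le`) leaves the stable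
case, `Stable.card_le`.

There let `D x` be the set of members of `N` containing `x`. If `D x` and `D y` were incomparable
for an edge `xy`, both ends could be moved independently, and `T`, folded onto this edge, would
embed. So `D` is monotone along each edge. Let `U` be the vertices from which `D` can rise along a
walk. Each component of `H ∖ U` has constant `D` and can be moved while any given neighbour in `U`
stays fixed, so a `T` in the blow-up would embed in the host: the blow-up is `T`-free. Every `A ∈ N`
contains a component of `H ∖ U`, so a copy is determined by its values at one representative per
component. -/

/-! ### Induction along a tree. -/

/-- Grow a finite tree from a vertex, one vertex at a time: each new vertex is joined to exactly
one earlier vertex. -/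
theorem isTree_induction {W : Type*} [Fintype W] [DecidableEq W] {T : SimpleGraph W}
    (hT : T.IsTree) (P : Finset W → Prop) (w₀ : W) (base : P {w₀})
    (step : ∀ (S : Finset W) (p q : W), p ∈ S → q ∉ S → T.Adj p q →
      (∀ p' ∈ S, T.Adj p' q → p' = p) → P S → P (insert q S)) : P univ := by
  classical
  -- The paths inside `S` make the earlier neighbour of `q` unique: two such neighbours would give
  -- two paths from `w₀` to `q` with different penultimate vertices.
  let Q : Finset W → Prop := fun S => P S ∧ w₀ ∈ S ∧
    ∀ s ∈ S, ∃ γ : T.Walk w₀ s, γ.IsPath ∧ ∀ v ∈ γ.support, v ∈ S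
  have hQ₀ : Q {w₀} := by
    refine ⟨base, by simp, fun s hs => ?_⟩
    obtain rfl : s = w₀ := by simpa using hs
    exact ⟨Walk.nil, by simp, by simp⟩
  obtain ⟨S, hS⟩ := (Set.toFinite {S | Q S}).exists_maximal ⟨_, hQ₀⟩
  obtain ⟨hPS, hw, hpath⟩ := hS.prop
  by_cases hu : S = univ
  · rwa [← hu]
  obtain ⟨v, hv⟩ : ∃ v, v ∉ S := by
    by_contra! h
    exact hu (eq_univ_iff_forall.2 h)
  obtain ⟨γ⟩ := hT.connected w₀ v
  obtain ⟨d, -, hp, hq⟩ := γ.exists_boundary_dart (S : Set W) hw hv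
  obtain ⟨⟨p, q⟩, hpq⟩ := d
  simp only [SetLike.mem_coe] at hp hq
  have hnew : Q (insert q S) := by
    refine ⟨step S p q hp hq hpq (fun p' hp' hadj => ?_) hPS, mem_insert_of_mem hw, ?_⟩
    · obtain ⟨α, hα, hαS⟩ := hpath p hp
      obtain ⟨β, hβ, hβS⟩ := hpath p' hp'
      have h1 := hα.concat (fun h => hq (hαS _ h)) hpq
      have h2 := hβ.concat (fun h => hq (hβS _ h)) hadj
      have := congrArg Walk.penultimate ((hT.existsUnique_path w₀ q).unique h2 h1)
      simpa using this
    · intro s hs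
      obtain rfl | hs := mem_insert.1 hs
      · obtain ⟨α, hα, hαS⟩ := hpath p hp
        refine ⟨α.concat hpq, hα.concat (fun h => hq (hαS _ h)) hpq, fun v hv => ?_⟩
        rw [Walk.support_concat] at hv
        simp only [List.mem_append, List.mem_singleton] at hv
        obtain hv | rfl := hv
        · exact mem_insert_of_mem (hαS _ hv)
        · exact mem_insert_self _ _
      · obtain ⟨α, hα, hαS⟩ := hpath s hs
        exact ⟨α, hα, fun v hv => mem_insert_of_mem (hαS v hv)⟩
  exact absurd (hS.le_of_ge hnew (subset_insert _ _) (mem_insert_self _ _)) hq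

/-! ### Embedding trees by means of stable families. -/

/-- For every `f ∈ Φ` and `A ∈ N` there are `s` members of `Φ` that agree with `f` outside `A` and
pairwise differ at every point of `A`. -/
def Stable {V X : Type*} (N : Finset (Finset V)) (s : ℕ) (Φ : Finset (V → X)) : Prop :=
  ∀ f ∈ Φ, ∀ A ∈ N, ∃ M ⊆ Φ, #M = s ∧ (∀ g ∈ M, ∀ v ∉ A, g v = f v) ∧
    ∀ g ∈ M, ∀ h ∈ M, g ≠ h → ∀ a ∈ A, g a ≠ h a

/-- A member of a stable family can be changed on `A` so as to avoid few given values. -/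
theorem Stable.exists_fresh {V X : Type*} [Fintype V] {N : Finset (Finset V)} {s : ℕ}
    {Φ : Finset (V → X)} (hΦ : Stable N s Φ) {f : V → X} (hf : f ∈ Φ) {A : Finset V}
    (hA : A ∈ N) {W : Type*} (S : Finset W) (F : W → V → X) (hs : #S * Fintype.card V < s) :
    ∃ g ∈ Φ, (∀ v ∉ A, g v = f v) ∧ ∀ w ∈ S, ∀ a ∈ A, g a ≠ F w a := by
  classical
  obtain ⟨M, hM, hcard, hoff, hdiff⟩ := hΦ f hf A hA
  -- Each of the fewer than `s` forbidden values `F w a` excludes at most one member of `M`, since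
  -- members of `M` differ at `a`.
  by_contra! hcon
  have hex : ∀ g ∈ M, ∃ z : W × V, z ∈ S ×ˢ (univ : Finset V) ∧ z.2 ∈ A ∧
      g z.2 = F z.1 z.2 := by
    intro g hg
    obtain ⟨w, hw, a, ha, h⟩ := hcon g (hM hg) (hoff g hg)
    exact ⟨(w, a), by simp [hw], ha, h⟩
  have hlt : #(S ×ˢ (univ : Finset V)) < #M := by
    rw [card_product, hcard]; exact hs
  obtain ⟨g₀, hg₀⟩ := card_pos.1 (Nat.zero_lt_of_lt hlt)
  have : Nonempty (W × V) := ⟨(hex g₀ hg₀).choose⟩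
  choose! z hz using hex
  obtain ⟨g, hg, h, hh, hne, heq⟩ :=
    exists_ne_map_eq_of_card_lt_of_maps_to hlt (f := z) (fun g hg => (hz g hg).1)
  refine hdiff g hg h hh hne _ (hz g hg).2.1 ?_
  rw [(hz g hg).2.2, heq, (hz h hh).2.2]

/-- Embedding a tree `T` along a homomorphism `φ : T → H` into a graph that contains a stable
family of properly coloured copies of `H`. Adjacent vertices with the same label are placed
by the same member of the family, and differently labelled pieces are placed by members that differ
on the common part of their sets `K`. -/
theorem isContained_of_stable {V W X I : Type*} [Fintype V] [Fintype W] {H : SimpleGraph V}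
    {T : SimpleGraph W} (hT : T.IsTree) {G : SimpleGraph X} (c : X → Option V)
    {N : Finset (Finset V)} {s : ℕ} {Φ : Finset (V → X)} (hΦ : Stable N s Φ)
    (hne : Φ.Nonempty) (hs : Fintype.card W * Fintype.card V < s)
    (hhom : ∀ f ∈ Φ, ∀ u v, H.Adj u v → G.Adj (f u) (f v))
    (hcol : ∀ f ∈ Φ, ∀ v, c (f v) = some v)
    (φ : T →g H) (l : W → I) (K : I → Set V)
    (hstep : ∀ p q, T.Adj p q → l p = l q ∨ K (l q) = ∅ ∨
      ∃ A ∈ N, φ p ∉ A ∧ K (l q) ⊆ (A : Set V))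
    (hinj : ∀ p q, φ p = φ q → l p = l q → p = q)
    (hmem : ∀ p, φ p ∈ K (l p) ∨ ∀ q, φ q = φ p → q = p) : T ⊑ G := by
  classical
  obtain ⟨f₀, hf₀⟩ := hne
  obtain ⟨w₀⟩ := hT.connected.nonempty
  have key : ∃ F : W → V → X, (∀ p, F p ∈ Φ) ∧
      (∀ p ∈ univ, ∀ q ∈ univ, T.Adj p q → G.Adj (F p (φ p)) (F q (φ q))) ∧
      ∀ p ∈ univ, ∀ q ∈ univ, ∀ y ∈ K (l p), y ∈ K (l q) → F p y = F q y →
        l p = l q := by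
    refine isTree_induction hT (fun S => ∃ F : W → V → X, (∀ p, F p ∈ Φ) ∧
      (∀ p ∈ S, ∀ q ∈ S, T.Adj p q → G.Adj (F p (φ p)) (F q (φ q))) ∧
      ∀ p ∈ S, ∀ q ∈ S, ∀ y ∈ K (l p), y ∈ K (l q) → F p y = F q y → l p = l q)
      w₀ ⟨fun _ => f₀, fun _ => hf₀, ?_, ?_⟩ ?_
    · intro p hp q hq h
      rw [mem_singleton] at hp hq
      subst hp hq
      exact absurd h (T.irrefl)
    · intro p hp q hq y _ _ _
      rw [mem_singleton] at hp hq
      rw [hp, hq]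
    rintro S p q hp hq hpq huniq ⟨F, hFΦ, hadj, hfresh⟩
    obtain ⟨g, hg, hgp, hgfresh⟩ : ∃ g ∈ Φ, g (φ p) = F p (φ p) ∧
        ∀ w ∈ S, ∀ y ∈ K (l w), y ∈ K (l q) → g y = F w y → l q = l w := by
      obtain h | h | ⟨A, hA, hpA, hKA⟩ := hstep p q hpq
      · refine ⟨F p, hFΦ p, rfl, fun w hw y hy hyq he => ?_⟩
        rw [← h] at hyq ⊢
        exact hfresh p hp w hw y hyq hy he
      · refine ⟨F p, hFΦ p, rfl, fun w hw y hy hyq he => ?_⟩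
        simp [h] at hyq
      · obtain ⟨g, hg, hoff, hne⟩ := hΦ.exists_fresh (hFΦ p) hA S F
          (lt_of_le_of_lt (Nat.mul_le_mul_right _ (card_le_univ S)) hs)
        exact ⟨g, hg, hoff _ hpA, fun w hw y hy hyq he => absurd he (hne w hw y (hKA hyq))⟩
    have hne : ∀ w ∈ S, w ≠ q := fun w hw h => hq (h ▸ hw)
    have hup : ∀ w ∈ S, Function.update F q g w = F w := fun w hw =>
      Function.update_of_ne (hne w hw) _ _
    have hedge : G.Adj (F p (φ p)) (g (φ q)) := hgp ▸ hhom g hg _ _ (φ.map_adj hpq)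
    refine ⟨Function.update F q g, fun w => ?_, fun a ha b hb hab => ?_,
      fun a ha b hb y hya hyb he => ?_⟩
    · by_cases h : w = q
      · subst h; simpa using hg
      · rw [Function.update_of_ne h]; exact hFΦ w
    · obtain rfl | ha' := mem_insert.1 ha <;> obtain rfl | hb' := mem_insert.1 hb
      · exact absurd hab (T.irrefl)
      · rw [hup b hb', Function.update_self]
        obtain rfl := huniq b hb' hab.symm
        exact hedge.symm
      · rw [hup a ha', Function.update_self]
        obtain rfl := huniq a ha' hab
        exact hedge
      · rw [hup a ha', hup b hb']
        exact hadj a ha' b hb' hab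
    · obtain rfl | ha' := mem_insert.1 ha <;> obtain rfl | hb' := mem_insert.1 hb
      · rfl
      · rw [hup b hb', Function.update_self] at he
        exact hgfresh b hb' y hyb hya he
      · rw [hup a ha', Function.update_self] at he
        exact (hgfresh a ha' y hya hyb he.symm).symm
      · rw [hup a ha', hup b hb'] at he
        exact hfresh a ha' b hb' y hya hyb he
  obtain ⟨F, hFΦ, hadj, hfresh⟩ := key
  refine ⟨⟨⟨fun w => F w (φ w), fun {a b} h => hadj a (mem_univ _) b (mem_univ _) h⟩, ?_⟩⟩
  intro p q hpq
  change F p (φ p) = F q (φ q) at hpq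
  -- The colour of an image recovers the vertex of `H`, so only vertices in one fibre of `φ` could
  -- collide.
  have hφ : φ p = φ q := by
    have := congrArg c hpq
    rw [hcol _ (hFΦ p), hcol _ (hFΦ q)] at this
    exact Option.some_injective _ this
  obtain h1 | h1 := hmem p
  · obtain h2 | h2 := hmem q
    · rw [← hφ] at hpq h2
      exact hinj p q hφ (hfresh p (mem_univ _) q (mem_univ _) _ h1 h2 hpq)
    · exact h2 p hφ
  · exact (h1 q hφ.symm).symm

/-- If the two ends of an edge of `H` can be varied independently of each other, then the graph
contains every tree. -/
theorem isContained_of_stable_of_adj {V W X : Type*} [Fintype V] [Fintype W] {H : SimpleGraph V}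
    {T : SimpleGraph W} (hT : T.IsTree) {G : SimpleGraph X} (c : X → Option V)
    {N : Finset (Finset V)} {s : ℕ} {Φ : Finset (V → X)} (hΦ : Stable N s Φ)
    (hne : Φ.Nonempty) (hs : Fintype.card W * Fintype.card V < s)
    (hhom : ∀ f ∈ Φ, ∀ u v, H.Adj u v → G.Adj (f u) (f v))
    (hcol : ∀ f ∈ Φ, ∀ v, c (f v) = some v) {x y : V} (hxy : H.Adj x y) {A B : Finset V}
    (hA : A ∈ N) (hB : B ∈ N) (hxA : x ∈ A) (hyA : y ∉ A) (hyB : y ∈ B) (hxB : x ∉ B) :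
    T ⊑ G := by
  -- Fold `T` onto the edge `xy` and give every vertex its own label, so that each new vertex is
  -- placed afresh: `A` moves `x` and fixes `y`, `B` does the reverse.
  let χ := hT.coloringTwo
  let φ : T →g H := ⟨fun w => if χ w = 0 then x else y, fun {a b} hab => by
    have := χ.valid hab
    by_cases ha : χ a = 0 <;> by_cases hb : χ b = 0
    · exact absurd (ha.trans hb.symm) this
    · simpa [ha, hb] using hxy
    · simpa [ha, hb] using hxy.symm
    · exact absurd (by omega) this⟩
  refine isContained_of_stable hT c hΦ hne hs hhom hcol φ id (fun w => {φ w})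
    (fun p q hpq => Or.inr (Or.inr ?_)) (fun p q _ h => h) (fun p => Or.inl rfl)
  have := χ.valid hpq
  by_cases hp : χ p = 0 <;> by_cases hq : χ q = 0
  · exact absurd (hp.trans hq.symm) this
  · exact ⟨B, hB, by simp [φ, hp, hxB], by simp [φ, hq, hyB]⟩
  · exact ⟨A, hA, by simp [φ, hp, hyA], by simp [φ, hq, hxA]⟩
  · exact absurd (by omega) this

/-- If the components of `H ∖ U` can be varied independently of each of their neighbours in `U`,
then the graph contains every tree that is contained in a `(U, t)`-blow-up. -/
theorem isContained_of_stable_of_blowUp {V W X : Type*} [Fintype V] [Fintype W]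
    {H : SimpleGraph V} {T : SimpleGraph W} (hT : T.IsTree) {G : SimpleGraph X} (c : X → Option V)
    {N : Finset (Finset V)} {s : ℕ} {Φ : Finset (V → X)} (hΦ : Stable N s Φ)
    (hne : Φ.Nonempty) (hs : Fintype.card W * Fintype.card V < s)
    (hhom : ∀ f ∈ Φ, ∀ u v, H.Adj u v → G.Adj (f u) (f v))
    (hcol : ∀ f ∈ Φ, ∀ v, c (f v) = some v) (U : Set V) {t : ℕ}
    (hU : ∀ x ∈ U, ∀ y : ↥Uᶜ, H.Adj x y → ∃ A ∈ N, x ∉ A ∧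
      ∀ z : ↥Uᶜ, (H.induce Uᶜ).connectedComponentMk z = (H.induce Uᶜ).connectedComponentMk y →
        (z : V) ∈ A)
    (hB : T ⊑ blowUp H U t) : T ⊑ G := by
  obtain ⟨ι⟩ := hB
  let π : ↥U ⊕ (↥Uᶜ × Fin t) → V := Sum.elim (fun u => u) (fun w => w.1)
  have hπ : ∀ a b, (blowUp H U t).Adj a b → H.Adj (π a) (π b) := by
    rintro (a | ⟨a, i⟩) (b | ⟨b, j⟩) h
    · exact h
    · exact h
    · exact h
    · exact h.2
  let φ : T →g H := ⟨fun w => π (ι w), fun {a b} hab => hπ _ _ (ι.toHom.map_adj hab)⟩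
  let l₀ : ↥U ⊕ (↥Uᶜ × Fin t) → Option ((H.induce Uᶜ).ConnectedComponent × Fin t) :=
    Sum.elim (fun _ => none) (fun w => some ((H.induce Uᶜ).connectedComponentMk w.1, w.2))
  -- Vertices over `U` need no freshness: the blow-up has only one vertex over each of them.
  let K : Option ((H.induce Uᶜ).ConnectedComponent × Fin t) → Set V
    | none => ∅
    | some z => {v | ∃ y : ↥Uᶜ, (H.induce Uᶜ).connectedComponentMk y = z.1 ∧ (y : V) = v}
  refine isContained_of_stable hT c hΦ hne hs hhom hcol φ (fun w => l₀ (ι w)) K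
    (fun p q hpq => ?_) (fun p q hφ hl => ?_) (fun p => ?_)
  · have hadj : (blowUp H U t).Adj (ι p) (ι q) := ι.toHom.map_adj hpq
    change l₀ (ι p) = l₀ (ι q) ∨ K (l₀ (ι q)) = ∅ ∨
      ∃ A ∈ N, π (ι p) ∉ A ∧ K (l₀ (ι q)) ⊆ (A : Set V)
    generalize ι p = a at hadj ⊢
    generalize ι q = b at hadj ⊢
    obtain u | ⟨y, i⟩ := b
    · exact Or.inr (Or.inl rfl)
    obtain x | ⟨x, j⟩ := a
    · obtain ⟨A, hA, hxA, hyA⟩ := hU x x.2 y hadj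
      refine Or.inr (Or.inr ⟨A, hA, hxA, ?_⟩)
      rintro _ ⟨z, hz, rfl⟩
      exact hyA z hz
    · obtain ⟨rfl, h⟩ : j = i ∧ H.Adj x y := hadj
      left
      have : (H.induce Uᶜ).connectedComponentMk x = (H.induce Uᶜ).connectedComponentMk y :=
        ConnectedComponent.sound (Adj.reachable (by simpa using h))
      simp [l₀, this]
  · apply ι.injective
    change π (ι p) = π (ι q) at hφ
    change l₀ (ι p) = l₀ (ι q) at hl
    change ι p = ι q
    generalize ι p = a at hφ hl ⊢
    generalize ι q = b at hφ hl ⊢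
    obtain a | ⟨a, i⟩ := a <;> obtain b | ⟨b, j⟩ := b
    · exact congrArg Sum.inl (Subtype.ext hφ)
    · simp [l₀] at hl
    · simp [l₀] at hl
    · obtain rfl : a = b := Subtype.ext hφ
      simp only [l₀, Sum.elim_inr, Option.some.injEq, Prod.mk.injEq, true_and] at hl
      rw [hl]
  · change π (ι p) ∈ K (l₀ (ι p)) ∨ ∀ q, π (ι q) = π (ι p) → q = p
    rcases h : ι p with u | ⟨w, i⟩
    · refine Or.inr fun q hq => ι.injective ?_
      change ι q = ι p
      rw [h]
      rcases h' : ι q with u' | ⟨w', j⟩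
      · rw [h'] at hq
        exact congrArg Sum.inl (Subtype.ext hq)
      · rw [h'] at hq
        exact absurd (show (w' : V) ∈ U from (show (w' : V) = u from hq) ▸ u.2) w'.2
    · exact Or.inl ⟨w, rfl, rfl⟩

/-! ### The size of a stable family. -/

/-- The points where two maps differ. -/
noncomputable def diffSet {V X : Type*} [Fintype V] (f g : V → X) : Finset V := by
  classical exact {v | f v ≠ g v}

theorem mem_diffSet {V X : Type*} [Fintype V] {f g : V → X} {v : V} :
    v ∈ diffSet f g ↔ f v ≠ g v := by
  simp [diffSet]

/-- A stable family of coloured copies of `H` in a `T`-free graph on `n` vertices has at most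
`n ^ r` members, where `r` is the number of components of `H ∖ U` for some `U` such that the
`(U, t)`-blow-up of `H` is `T`-free. -/
theorem Stable.card_le {V W X : Type*} [Fintype V] [Fintype W] [Fintype X] [Nonempty X]
    {H : SimpleGraph V}
    {T : SimpleGraph W} (hT : T.IsTree) {G : SimpleGraph X} (hG : T.Free G) (c : X → Option V)
    {N : Finset (Finset V)} {s : ℕ} {Φ : Finset (V → X)} (hΦ : Stable N s Φ)
    (hs : Fintype.card W * Fintype.card V < s)
    (hhom : ∀ f ∈ Φ, ∀ u v, H.Adj u v → G.Adj (f u) (f v))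
    (hcol : ∀ f ∈ Φ, ∀ v, c (f v) = some v) (hN : ∀ A ∈ N, A.Nonempty)
    (hdiff : ∀ f ∈ Φ, ∀ g ∈ Φ, f ≠ g → diffSet f g ∈ N) :
    #Φ ≤ Fintype.card X ^ blowUpExponent H T := by
  classical
  obtain rfl | hne := Φ.eq_empty_or_nonempty
  · simp
  let D : V → Finset (Finset V) := fun x => {A ∈ N | x ∈ A}
  have memD : ∀ x A, A ∈ D x ↔ A ∈ N ∧ x ∈ A := fun x A => by simp [D]
  have hcomp : ∀ x y, H.Adj x y → D x ⊆ D y ∨ D y ⊆ D x := by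
    intro x y hxy
    by_contra! h
    obtain ⟨A, hA, hA'⟩ := not_subset.1 h.1
    obtain ⟨B, hB, hB'⟩ := not_subset.1 h.2
    rw [memD] at hA hB hA' hB'
    exact hG (isContained_of_stable_of_adj hT c hΦ hne hs hhom hcol hxy hA.1 hB.1 hA.2
      (fun h => hA' ⟨hA.1, h⟩) hB.2 (fun h => hB' ⟨hB.1, h⟩))
  let R : V → V → Prop := fun a b => H.Adj a b ∧ D a ⊆ D b
  let U : Set V := {x | ∃ z, Relation.ReflTransGen R x z ∧ D x ⊂ D z}
  have hUU : ∀ x ∈ U, ∀ y ∉ U, H.Adj x y → ¬ D y ⊆ D x := by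
    rintro x ⟨z, hxz, hlt⟩ y hy hadj hle
    exact hy ⟨z, Relation.ReflTransGen.head ⟨hadj.symm, hle⟩ hxz, hle.trans_ssubset hlt⟩
  have hYY : ∀ x ∉ U, ∀ y ∉ U, H.Adj x y → D x = D y := by
    have key : ∀ x ∉ U, ∀ y, H.Adj x y → D x ⊆ D y → D x = D y := by
      intro x hx y hxy hle
      by_contra hne
      exact hx ⟨y, Relation.ReflTransGen.single ⟨hxy, hle⟩, hle.ssubset_of_ne hne⟩
    intro x hx y hy hxy
    obtain h | h := hcomp x y hxy
    · exact key x hx y hxy h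
    · exact (key y hy x hxy.symm h).symm
  have hconst : ∀ x y : ↥Uᶜ, (H.induce Uᶜ).connectedComponentMk x =
      (H.induce Uᶜ).connectedComponentMk y → D x = D y := by
    intro x y hxy
    obtain ⟨γ⟩ := ConnectedComponent.exact hxy
    induction γ with
    | nil => rfl
    | @cons a b d hab γ ih =>
      exact (hYY a a.2 b b.2 (by simpa using hab)).trans (ih (ConnectedComponent.sound ⟨γ⟩))
  have hfree : T.Free (blowUp H U (Fintype.card W)) := by
    refine fun hB => hG (isContained_of_stable_of_blowUp hT c hΦ hne hs hhom hcol U ?_ hB)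
    intro x hx y hxy
    obtain ⟨A, hA, hA'⟩ := not_subset.1 (hUU x hx y y.2 hxy)
    have hAN := ((memD _ _).1 hA).1
    refine ⟨A, hAN, fun h => hA' ((memD _ _).2 ⟨hAN, h⟩), fun z hz => ?_⟩
    rw [← hconst z y hz] at hA
    exact ((memD _ _).1 hA).2
  have hhit : ∀ A ∈ N, ∃ k : (H.induce Uᶜ).ConnectedComponent, ((Quot.out k : ↥Uᶜ) : V) ∈ A := by
    intro A hA
    -- A maximiser `x` of `#(D x)` on `A` is outside `U`: otherwise some `z` has `D x ⊂ D z`, and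
    -- then `A ∈ D z` puts `z` in `A`.
    obtain ⟨x, hxA, hmax⟩ := exists_max_image A (fun x => #(D x)) (hN A hA)
    have hx : x ∉ U := by
      rintro ⟨z, -, hlt⟩
      have hz := (memD _ _).1 (hlt.1 ((memD _ _).2 ⟨hA, hxA⟩))
      exact absurd (hmax z hz.2) (not_le.2 (card_lt_card hlt))
    refine ⟨(H.induce Uᶜ).connectedComponentMk ⟨x, hx⟩, ?_⟩
    have := hconst (Quot.out ((H.induce Uᶜ).connectedComponentMk ⟨x, hx⟩)) ⟨x, hx⟩ (Quot.out_eq _)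
    exact ((memD _ _).1 (this ▸ (memD _ _).2 ⟨hA, hxA⟩)).2
  let ρ : (V → X) → ((H.induce Uᶜ).ConnectedComponent → X) :=
    fun f k => f ((Quot.out k : ↥Uᶜ) : V)
  have hρ : Set.InjOn ρ (Φ : Set (V → X)) := by
    intro f hf g hg hfg
    by_contra hne
    obtain ⟨k, hk⟩ := hhit _ (hdiff f hf g hg hne)
    exact mem_diffSet.1 hk (congrFun hfg k)
  have h1 : #Φ ≤ Fintype.card X ^ Nat.card (H.induce Uᶜ).ConnectedComponent := by
    have := card_le_card_of_injOn ρ (fun f _ => mem_univ (ρ f)) hρ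
    rwa [card_univ, Fintype.card_fun, ← Nat.card_eq_fintype_card
      (α := (H.induce Uᶜ).ConnectedComponent)] at this
  refine h1.trans (Nat.pow_le_pow_right Fintype.card_pos ?_)
  exact le_sup (f := fun U : Set V => Nat.card (H.induce Uᶜ).ConnectedComponent)
    (by simpa using hfree)

/-! ### Reduction to stable families and averaging over colourings. -/

/-- Every family of maps splits into a stable family and a bounded number of families, in each of
which no two maps differ exactly on some member of `N`. -/
theorem exists_stable_and_labelling {V X : Type*} [Fintype V] (N : Finset (Finset V))
    (hN : ∀ A ∈ N, A.Nonempty) (s : ℕ) (Φ : Finset (V → X)) :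
    ∃ Φ₀ ⊆ Φ, Stable N s Φ₀ ∧ ∃ l : (V → X) → Finset V × Option (Fin s × V),
      (∀ f ∈ Φ, f ∉ Φ₀ → (l f).1 ∈ N) ∧
      ∀ f ∈ Φ, f ∉ Φ₀ → ∀ g ∈ Φ, g ∉ Φ₀ → l f = l g → diffSet f g ≠ (l f).1 := by
  classical
  induction Φ using Finset.strongInduction with
  | H Φ ih =>
  by_cases hst : Stable N s Φ
  · exact ⟨Φ, Subset.rfl, hst, fun _ => (∅, none), fun f hf hf' => absurd hf hf',
      fun f hf hf' => absurd hf hf'⟩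
  simp only [Stable, not_forall] at hst
  obtain ⟨f, hf, A, hA, hM⟩ := hst
  let Γ : Finset (V → X) := {g ∈ Φ | ∀ v ∉ A, g v = f v}
  have hfΓ : f ∈ Γ := by simp [Γ, hf]
  let Q : Finset (V → X) → Prop := fun M => M ⊆ Γ ∧ ∀ g ∈ M, ∀ h ∈ M, g ≠ h → ∀ a ∈ A, g a ≠ h a
  obtain ⟨M, hMmax⟩ := (Γ.powerset.finite_toSet.subset (t := {M | Q M})
    (fun M h => by simpa using h.1)).exists_maximal ⟨∅, by simp [Q]⟩
  obtain ⟨hMΓ, hMd⟩ := hMmax.prop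
  have hMs : #M < s := by
    by_contra! h
    obtain ⟨M', hM', hcard⟩ := exists_subset_card_eq h
    exact hM ⟨M', (hM'.trans hMΓ).trans (filter_subset _ _), hcard,
      fun g hg => (mem_filter.1 (hMΓ (hM' hg))).2,
      fun g hg h hh => hMd g (hM' hg) h (hM' hh)⟩
  -- By maximality of `M`, every member of `Γ` meets one of fewer than `s` maps at a point of `A`.
  -- This map and point form its label, so equal labels force agreement somewhere on `A`.
  have hcover : ∀ g ∈ Γ, ∃ z : (V → X) × V, z.1 ∈ M ∧ z.2 ∈ A ∧ g z.2 = z.1 z.2 := by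
    intro g hg
    by_cases hgM : g ∈ M
    · obtain ⟨a, ha⟩ := hN A hA
      exact ⟨(g, a), hgM, ha, rfl⟩
    by_contra! hcon
    refine hgM (hMmax.le_of_ge (y := insert g M) ⟨insert_subset hg hMΓ, ?_⟩ (subset_insert _ _)
      (mem_insert_self _ _))
    intro p hp q hq hpq a ha
    obtain rfl | hp' := mem_insert.1 hp <;> obtain rfl | hq' := mem_insert.1 hq
    · exact absurd rfl hpq
    · exact hcon (q, a) hq' ha
    · exact (hcon (p, a) hp' ha).symm
    · exact hMd p hp' q hq' hpq a ha
  have : Nonempty ((V → X) × V) := ⟨(hcover f hfΓ).choose⟩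
  choose! z hz using hcover
  let e : (V → X) → Fin s := fun m =>
    if h : m ∈ M then Fin.castLE hMs.le (M.equivFin ⟨m, h⟩) else ⟨0, Nat.zero_lt_of_lt hMs⟩
  have he : ∀ m ∈ M, ∀ m' ∈ M, e m = e m' → m = m' := by
    intro m hm m' hm' h
    simp only [e, hm, hm', dif_pos] at h
    simpa using M.equivFin.injective (Fin.castLE_injective _ h)
  have hlt : Φ \ Γ ⊂ Φ :=
    (ssubset_iff_of_subset sdiff_subset).2 ⟨f, hf, fun h => (mem_sdiff.1 h).2 hfΓ⟩
  obtain ⟨Φ₀, hΦ₀, hst, l, hlN, hl⟩ := ih _ hlt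
  refine ⟨Φ₀, hΦ₀.trans sdiff_subset, hst,
    fun g => if g ∈ Γ then (A, some (e (z g).1, (z g).2)) else l g, ?_, ?_⟩
  · intro g hg hg₀
    by_cases hgΓ : g ∈ Γ
    · simpa [hgΓ] using hA
    · simpa [hgΓ] using hlN g (mem_sdiff.2 ⟨hg, hgΓ⟩) hg₀
  -- If `g ∈ Γ` and `h` differ exactly on `A`, then `h` also agrees with `f` off `A`, so `h ∈ Γ`.
  · have cross : ∀ g ∈ Γ, ∀ h ∈ Φ, h ∉ Γ → diffSet g h ≠ A := by
      intro g hg h hh hhΓ heq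
      refine hhΓ (mem_filter.2 ⟨hh, fun v hv => ?_⟩)
      rw [← heq, mem_diffSet, not_not] at hv
      rw [← hv]
      exact (mem_filter.1 hg).2 v (by rw [← heq, mem_diffSet, not_not]; exact hv)
    intro g hg hg₀ h hh hh₀ hgh
    by_cases hgΓ : g ∈ Γ <;> by_cases hhΓ : h ∈ Γ
    · simp only [hgΓ, hhΓ, if_true, Prod.mk.injEq, Option.some.injEq, true_and] at hgh ⊢
      obtain ⟨h1, h2⟩ := hgh
      have h1 := he _ (hz g hgΓ).1 _ (hz h hhΓ).1 h1
      intro heq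
      have ha : (z g).2 ∈ diffSet g h := heq ▸ (hz g hgΓ).2.1
      refine mem_diffSet.1 ha ?_
      rw [(hz g hgΓ).2.2, h1, h2, (hz h hhΓ).2.2]
    · simp only [hgΓ, if_true]
      exact cross g hgΓ h hh hhΓ
    · simp only [hgΓ, hhΓ, if_true, if_false] at hgh ⊢
      rw [hgh]
      have hsymm : diffSet g h = diffSet h g := by
        ext v
        simp only [mem_diffSet, ne_comm]
      rw [hsymm]
      exact cross h hhΓ g hg hgΓ
    · simp only [hgΓ, hhΓ, if_false] at hgh ⊢
      exact hl g (mem_sdiff.2 ⟨hg, hgΓ⟩) hg₀ h (mem_sdiff.2 ⟨hh, hhΓ⟩) hh₀ hgh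

/-- A bound for the number of coloured copies of `H` in a `T`-free graph. -/
theorem card_colored_le {V W X : Type*} [Fintype V] [Fintype W] [Fintype X] [Nonempty X]
    {H : SimpleGraph V}
    {T : SimpleGraph W} (hT : T.IsTree) {G : SimpleGraph X} (hG : T.Free G) (c : X → Option V)
    {s : ℕ} (hs : Fintype.card W * Fintype.card V < s) (m : ℕ) (N : Finset (Finset V))
    (hm : #N ≤ m) (hN : ∀ A ∈ N, A.Nonempty) (Φ : Finset (V → X))
    (hhom : ∀ f ∈ Φ, ∀ u v, H.Adj u v → G.Adj (f u) (f v))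
    (hcol : ∀ f ∈ Φ, ∀ v, c (f v) = some v)
    (hdiff : ∀ f ∈ Φ, ∀ g ∈ Φ, f ≠ g → diffSet f g ∈ N) :
    #Φ ≤ (Fintype.card (Finset V × Option (Fin s × V)) + 1) ^ m *
      Fintype.card X ^ blowUpExponent H T := by
  classical
  induction m generalizing N Φ with
  | zero =>
    obtain rfl : N = ∅ := card_eq_zero.1 (Nat.le_zero.1 hm)
    simpa using Stable.card_le hT hG c (N := ∅) (s := s) (by simp [Stable]) hs hhom hcol hN hdiff
  | succ m ih =>
    obtain ⟨Φ₀, hΦ₀, hst, l, hlN, hl⟩ := exists_stable_and_labelling N hN s Φ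
    set L := Fintype.card (Finset V × Option (Fin s × V)) with hL
    set B := Fintype.card X ^ blowUpExponent H T with hB
    have h0 : #Φ₀ ≤ B := hst.card_le hT hG c hs (fun f hf => hhom f (hΦ₀ hf))
      (fun f hf => hcol f (hΦ₀ hf)) hN
      (fun f hf g hg => hdiff f (hΦ₀ hf) g (hΦ₀ hg))
    have h1 : #(Φ \ Φ₀) ≤ L * ((L + 1) ^ m * B) := by
      rw [card_eq_sum_card_fiberwise (f := l) (t := univ) (by simp), hL, ← card_univ]
      rw [← smul_eq_mul]
      refine sum_le_card_nsmul _ _ _ fun k _ => ?_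
      obtain hemp | ⟨f₀, hf₀⟩ := ({f ∈ Φ \ Φ₀ | l f = k} : Finset _).eq_empty_or_nonempty
      · rw [hemp]; simp
      have hmem : ∀ f ∈ ({f ∈ Φ \ Φ₀ | l f = k} : Finset _), f ∈ Φ ∧ f ∉ Φ₀ ∧ l f = k := by
        intro f hf
        simpa [and_assoc] using hf
      obtain ⟨hf1, hf2, hf3⟩ := hmem f₀ hf₀
      have hkN : k.1 ∈ N := hf3 ▸ hlN f₀ hf1 hf2
      -- Within one label class the difference set `k.1` no longer occurs.
      refine ih (N.erase k.1) ?_ (fun A hA => hN A (mem_of_mem_erase hA)) _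
        (fun f hf => hhom f (hmem f hf).1) (fun f hf => hcol f (hmem f hf).1) ?_
      · rw [card_erase_of_mem hkN]; omega
      · intro f hf g hg hfg
        obtain ⟨a1, a2, a3⟩ := hmem f hf
        obtain ⟨b1, b2, b3⟩ := hmem g hg
        refine mem_erase.2 ⟨?_, hdiff f a1 g b1 hfg⟩
        rw [← a3]
        exact hl f a1 a2 g b1 b2 (a3.trans b3.symm)
    have h2 : #Φ = #(Φ \ Φ₀) + #Φ₀ := (card_sdiff_add_card_eq_card hΦ₀).symm
    have h3 : 1 ≤ (L + 1) ^ m := Nat.one_le_pow _ _ (by omega)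
    calc #Φ ≤ L * ((L + 1) ^ m * B) + 1 * B := by rw [h2]; omega
      _ ≤ L * ((L + 1) ^ m * B) + (L + 1) ^ m * B := by gcongr
      _ = (L + 1) ^ (m + 1) * B := by ring

/-- The maps that extend the inverse of a given injective map are a positive proportion of all
colourings. -/
theorem card_fun_le_mul_card_colorings {V X : Type*} [Fintype V] [Fintype X] [DecidableEq V]
    [DecidableEq X] {f : V → X} (hf : Function.Injective f) :
    Fintype.card (X → Option V) ≤ Fintype.card (V → Option V) *
      #{c : X → Option V | ∀ v, c (f v) = some v} := by
  rw [← card_univ, ← card_univ (α := V → Option V), ← card_product]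
  -- Overwrite `c` on the range of `f` by the required colours; the first component remembers what
  -- was lost.
  refine card_le_card_of_injOn (fun c => (c ∘ f, Function.extend f some c)) ?_ ?_
  · intro c _
    simp [hf.extend_apply]
  · intro c _ c' _ h
    simp only [Prod.mk.injEq] at h
    ext1 x
    by_cases hx : ∃ v, f v = x
    · obtain ⟨v, rfl⟩ := hx
      exact congrFun h.1 v
    · have := congrFun h.2 x
      rwa [Function.extend_apply' _ _ _ hx, Function.extend_apply' _ _ _ hx] at this

/-- The number of copies of `H` in a `T`-free graph on `n ≥ 1` vertices is `O(n ^ r)`. -/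
theorem exists_copyCount_le {V W : Type*} [Fintype V] [Fintype W] (H : SimpleGraph V)
    {T : SimpleGraph W} (hT : T.IsTree) :
    ∃ C : ℕ, ∀ n, 0 < n → ∀ G : SimpleGraph (Fin n), T.Free G →
      G.copyCount H ≤ C * n ^ blowUpExponent H T := by
  classical
  set s := Fintype.card W * Fintype.card V + 1 with hs
  set B := (Fintype.card (Finset V × Option (Fin s × V)) + 1) ^
    #((univ : Finset (Finset V)).erase ∅) with hB
  refine ⟨Fintype.card (V → Option V) * B, fun n hn G hG => ?_⟩
  have : Nonempty (Fin n) := ⟨⟨0, hn⟩⟩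
  let Φ : Finset (V → Fin n) := univ.image fun φ : Copy H G => ⇑φ
  have hΦ : G.copyCount H ≤ #Φ := by
    refine copyCount_le_labelledCopyCount.trans_eq ?_
    rw [card_image_of_injective _ DFunLike.coe_injective, labelledCopyCount, card_univ]
    congr!
  have hc : ∀ c : Fin n → Option V, #{f ∈ Φ | ∀ v, c (f v) = some v} ≤
      B * n ^ blowUpExponent H T := by
    intro c
    have hmem : ∀ f ∈ ({f ∈ Φ | ∀ v, c (f v) = some v} : Finset _),
        (∃ φ : Copy H G, ⇑φ = f) ∧ ∀ v, c (f v) = some v := by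
      intro f hf
      simpa [Φ] using hf
    have := card_colored_le hT hG c (s := s) (by omega) _ ((univ : Finset (Finset V)).erase ∅)
      le_rfl (fun A hA => nonempty_iff_ne_empty.2 (ne_of_mem_erase hA))
      {f ∈ Φ | ∀ v, c (f v) = some v}
      (H := H) (fun f hf u v huv => ?_) (fun f hf => (hmem f hf).2) (fun f hf g hg hfg => ?_)
    · rwa [Fintype.card_fin n] at this
    · obtain ⟨⟨φ, rfl⟩, -⟩ := hmem f hf
      exact φ.toHom.map_adj huv
    · obtain ⟨v, hv⟩ := Function.ne_iff.1 hfg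
      exact mem_erase.2 ⟨ne_empty_of_mem (mem_diffSet.2 hv), mem_univ _⟩
  -- The extra colour `none` keeps this positive even when `V` is empty.
  have hpos : 0 < Fintype.card (Fin n → Option V) := Fintype.card_pos
  have hmain : #Φ * Fintype.card (Fin n → Option V) ≤
      Fintype.card (V → Option V) * B * n ^ blowUpExponent H T *
        Fintype.card (Fin n → Option V) := by
    calc #Φ * Fintype.card (Fin n → Option V)
        = ∑ _f ∈ Φ, Fintype.card (Fin n → Option V) := by rw [sum_const, smul_eq_mul]
      _ ≤ ∑ f ∈ Φ, Fintype.card (V → Option V) *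
            #{c : Fin n → Option V | ∀ v, c (f v) = some v} := by
          refine sum_le_sum fun f hf => ?_
          obtain ⟨φ, -, rfl⟩ := mem_image.1 hf
          exact card_fun_le_mul_card_colorings φ.injective
      _ = Fintype.card (V → Option V) *
            ∑ c : Fin n → Option V, #{f ∈ Φ | ∀ v, c (f v) = some v} := by
          rw [← mul_sum]
          congr 1
          exact sum_card_bipartiteAbove_eq_sum_card_bipartiteBelow
            (fun (f : V → Fin n) (c : Fin n → Option V) => ∀ v, c (f v) = some v)
      _ ≤ Fintype.card (V → Option V) *
            ∑ _c : Fin n → Option V, B * n ^ blowUpExponent H T :=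
          Nat.mul_le_mul_left _ (sum_le_sum fun c _ => hc c)
      _ = _ := by rw [sum_const, smul_eq_mul, card_univ]; ring
  exact hΦ.trans (Nat.le_of_mul_le_mul_right hmain hpos)

/-! ### The lower bound from blow-ups. -/

/-- A graph on `t` vertices contained in some blow-up is contained in the `t`-fold blow-up. -/
theorem isContained_blowUp_card {V W : Type*} [Fintype W] {H : SimpleGraph V}
    {T : SimpleGraph W} [Nonempty W] {U : Set V} {m : ℕ} (h : T ⊑ blowUp H U m) :
    T ⊑ blowUp H U (Fintype.card W) := by
  classical
  obtain ⟨ι⟩ := h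
  let P : Fin m → W → Prop := fun i w => ∃ y, ι w = Sum.inr (y, i)
  -- Index each copy that meets `T` by a vertex of `T` lying in it; the other copies may share an
  -- arbitrary index.
  let e : Fin m → Fin (Fintype.card W) := fun i =>
    if h : ∃ w, P i w then Fintype.equivFin W h.choose
    else Fintype.equivFin W (Classical.arbitrary W)
  have he : ∀ i j, (∃ w, P i w) → (∃ w, P j w) → e i = e j → i = j := by
    intro i j hi hj hij
    simp only [e, hi, hj, dif_pos] at hij
    have hw := (Fintype.equivFin W).injective hij
    obtain ⟨y, hy⟩ := hi.choose_spec
    obtain ⟨y', hy'⟩ := hj.choose_spec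
    rw [hw, hy'] at hy
    simp only [Sum.inr.injEq, Prod.mk.injEq] at hy
    exact hy.2.symm
  let F : ↥U ⊕ (↥Uᶜ × Fin m) → ↥U ⊕ (↥Uᶜ × Fin (Fintype.card W)) := Sum.map id (Prod.map id e)
  have hF : ∀ a b, (blowUp H U m).Adj a b → (blowUp H U (Fintype.card W)).Adj (F a) (F b) := by
    rintro (a | ⟨a, i⟩) (b | ⟨b, j⟩) h
    · exact h
    · exact h
    · exact h
    · exact ⟨congrArg e h.1, h.2⟩
  refine ⟨⟨⟨fun w => F (ι w), fun {a b} hab => hF _ _ (ι.toHom.map_adj hab)⟩, ?_⟩⟩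
  intro p q hpq
  change F (ι p) = F (ι q) at hpq
  apply ι.injective
  change ι p = ι q
  rcases hp : ι p with a | ⟨a, i⟩ <;> rcases hq : ι q with b | ⟨b, j⟩ <;> rw [hp, hq] at hpq
  · simpa [F] using hpq
  · simp [F] at hpq
  · simp [F] at hpq
  · simp only [F, Sum.map_inr, Prod.map_apply, id_eq, Sum.inr.injEq, Prod.mk.injEq] at hpq
    rw [hpq.1, he i j ⟨p, a, hp⟩ ⟨q, b, hq⟩ hpq.2]

/-- A graph without isolated vertices that is contained in `G.map e` is contained in `G`. -/
theorem isContained_of_isContained_map {W X Y : Type*} {T : SimpleGraph W} {G : SimpleGraph X}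
    (e : X ↪ Y) (hT : ∀ w, ∃ v, T.Adj w v) (h : T ⊑ G.map e) : T ⊑ G := by
  obtain ⟨ι⟩ := h
  have hadj : ∀ a b, T.Adj a b → ∃ x y, G.Adj x y ∧ e x = ι a ∧ e y = ι b := fun a b hab =>
    (SimpleGraph.map_adj _ _ _ _).1 (ι.toHom.map_adj hab)
  have hex : ∀ w, ∃ x, e x = ι w := fun w => by
    obtain ⟨v, hv⟩ := hT w
    obtain ⟨x, y, -, hx, -⟩ := hadj w v hv
    exact ⟨x, hx⟩
  choose g hg using hex
  refine ⟨⟨⟨g, fun {a b} hab => ?_⟩, fun a b hab => ι.injective ?_⟩⟩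
  · obtain ⟨x, y, hxy, hx, hy⟩ := hadj a b hab
    rw [← hg] at hx hy
    rwa [e.injective hx, e.injective hy] at hxy
  · change ι a = ι b
    rw [← hg, ← hg]
    exact congrArg e hab

/-- Choosing one of the `m` copies for each component of `H ∖ U` gives a copy of `H` in the
`(U, m)`-blow-up. -/
noncomputable def blowUpCopy {V : Type*} (H : SimpleGraph V) (U : Set V) (m : ℕ)
    (k : (H.induce Uᶜ).ConnectedComponent → Fin m) : Copy H (blowUp H U m) := by
  classical
  let F : V → ↥U ⊕ (↥Uᶜ × Fin m) := fun v =>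
    if h : v ∈ U then Sum.inl ⟨v, h⟩
    else Sum.inr (⟨v, h⟩, k ((H.induce Uᶜ).connectedComponentMk ⟨v, h⟩))
  refine ⟨⟨F, fun {a b} hab => ?_⟩, fun a b hab => ?_⟩
  · by_cases ha : a ∈ U <;> by_cases hb : b ∈ U <;> simp only [F, ha, hb, dif_pos, dif_neg,
      not_false_eq_true]
    · exact hab
    · exact hab
    · exact hab
    · refine ⟨congrArg k (ConnectedComponent.sound (Adj.reachable ?_)), hab⟩
      exact hab
  · change F a = F b at hab
    by_cases ha : a ∈ U <;> by_cases hb : b ∈ U <;> simp [F, ha, hb] at hab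
    · exact hab
    · exact hab.1

theorem blowUpCopy_apply {V : Type*} (H : SimpleGraph V) (U : Set V) (m : ℕ)
    (k : (H.induce Uᶜ).ConnectedComponent → Fin m) (v : ↥Uᶜ) :
    blowUpCopy H U m k v = Sum.inr (v, k ((H.induce Uᶜ).connectedComponentMk v)) :=
  dif_neg v.2

/-- The number of copies of `H` in the `(U, m)`-blow-up with isolated vertices added. -/
theorem pow_le_copyCount_map_blowUp {V X : Type*} [Fintype V] [Fintype X] (H : SimpleGraph V)
    (U : Set V) (m : ℕ) (e : (↥U ⊕ (↥Uᶜ × Fin m)) ↪ X) :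
    m ^ Nat.card (H.induce Uᶜ).ConnectedComponent ≤ ((blowUp H U m).map e).copyCount H := by
  classical
  let σ : ((H.induce Uᶜ).ConnectedComponent → Fin m) → Copy H ((blowUp H U m).map e) :=
    fun k => (Embedding.map e (blowUp H U m)).toCopy.comp (blowUpCopy H U m k)
  have hσ : ∀ k v, σ k v = e (blowUpCopy H U m k v) := fun k v => rfl
  have hinj : Function.Injective fun k => (σ k).toSubgraph := by
    intro k k' hkk
    funext C
    obtain ⟨w, rfl⟩ := C.exists_rep
    change k ((H.induce Uᶜ).connectedComponentMk w) = k' ((H.induce Uᶜ).connectedComponentMk w)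
    -- The only vertex over `w` in the image of `σ k'` lies in copy `k' C`, so the subgraph itself,
    -- not only the embedding, determines `k`.
    have hw : σ k w ∈ (σ k').toSubgraph.verts := by
      rw [← show (σ k).toSubgraph = (σ k').toSubgraph from hkk]
      exact ⟨w, trivial, rfl⟩
    obtain ⟨v, -, hv⟩ := hw
    change σ k' v = σ k w at hv
    rw [hσ, hσ, blowUpCopy_apply] at hv
    have hv := e.injective hv
    by_cases hvU : v ∈ U
    · rw [show blowUpCopy H U m k' v = Sum.inl ⟨v, hvU⟩ from dif_pos hvU] at hv
      simp at hv
    · rw [blowUpCopy_apply H U m k' ⟨v, hvU⟩] at hv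
      simp only [Sum.inr.injEq, Prod.mk.injEq] at hv
      rw [← hv.2, ← hv.1]
  rw [copyCount_eq_card_image_copyToSubgraph, Nat.card_eq_fintype_card]
  calc m ^ Fintype.card (H.induce Uᶜ).ConnectedComponent
      = #((univ : Finset ((H.induce Uᶜ).ConnectedComponent → Fin m)).image
          fun k => (σ k).toSubgraph) := by
        rw [card_image_of_injective _ hinj, card_univ, Fintype.card_fun, Fintype.card_fin]
    _ ≤ _ := card_le_card (image_subset_iff.2 fun k _ => mem_image_of_mem _ (mem_univ _))

/-- The lower bound for the extremal number, from blow-ups. -/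
theorem pow_le_genExtremalNumber {V W : Type*} [Fintype V] [Fintype W] [Nontrivial W]
    {H : SimpleGraph V} {T : SimpleGraph W} (hT : T.IsTree) (hfree : T.Free H) (n : ℕ)
    (hn : Fintype.card V + 1 ≤ n) :
    (n / (Fintype.card V + 1)) ^ blowUpExponent H T ≤ genExtremalNumber n H T := by
  classical
  -- The blow-up has at most `|V| * m` vertices; the `+ 1` avoids division by zero when `V` is
  -- empty.
  set m := n / (Fintype.card V + 1) with hm
  have hm1 : 1 ≤ m := (Nat.one_le_div_iff (by omega)).2 hn
  obtain ⟨U, hU, hUr⟩ : ∃ U : Set V, T.Free (blowUp H U (Fintype.card W)) ∧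
      blowUpExponent H T = Nat.card (H.induce Uᶜ).ConnectedComponent := by
    have hne : ({U : Set V | T.Free (blowUp H U (Fintype.card W))} : Finset (Set V)).Nonempty := by
      refine ⟨Set.univ, mem_filter.2 ⟨mem_univ _, fun h => hfree (h.trans ⟨⟨⟨Sum.elim (fun u => u)
        (fun w => w.1), ?_⟩, ?_⟩⟩)⟩⟩
      · rintro (a | ⟨a, i⟩) (b | ⟨b, j⟩) h
        · exact h
        · exact h
        · exact h
        · exact h.2
      · rintro (a | ⟨a, i⟩) (b | ⟨b, j⟩) h
        · exact congrArg Sum.inl (Subtype.ext h)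
        · exact absurd (Set.mem_univ _) b.2
        · exact absurd (Set.mem_univ _) a.2
        · exact absurd (Set.mem_univ _) a.2
    obtain ⟨U, hU, h⟩ := exists_mem_eq_sup _ hne
      (fun U : Set V => Nat.card (H.induce Uᶜ).ConnectedComponent)
    exact ⟨U, by simpa using hU, h⟩
  have hcard : Fintype.card (↥U ⊕ (↥Uᶜ × Fin m)) ≤ Fintype.card (Fin n) := by
    rw [Fintype.card_sum, Fintype.card_prod, Fintype.card_fin, Fintype.card_fin]
    have h1 : Fintype.card ↥U + Fintype.card ↥Uᶜ = Fintype.card V := by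
      rw [← Fintype.card_sum]
      exact Fintype.card_congr (Equiv.Set.sumCompl U)
    calc Fintype.card ↥U + Fintype.card ↥Uᶜ * m
        ≤ Fintype.card ↥U * m + Fintype.card ↥Uᶜ * m := by
          gcongr; exact Nat.le_mul_of_pos_right _ hm1
      _ = Fintype.card V * m := by rw [← add_mul, h1]
      _ ≤ (Fintype.card V + 1) * m := by gcongr; omega
      _ ≤ n := Nat.mul_div_le _ _
  obtain ⟨e⟩ := Function.Embedding.nonempty_of_card_le hcard
  rw [hUr]
  refine (pow_le_copyCount_map_blowUp H U m e).trans ?_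
  refine le_sup (f := fun G : SimpleGraph (Fin n) => G.copyCount H) ?_
  refine mem_filter.2 ⟨mem_univ _, fun h => hU (isContained_blowUp_card
    (isContained_of_isContained_map e (fun w => ?_) h))⟩
  exact hT.connected.preconnected.exists_adj_of_nontrivial w

end GenTuran

/-! ### Combining the two bounds. -/

theorem theorem2 {V W : Type*} [Fintype V] [Fintype W] [Nontrivial W]
    (H : SimpleGraph V) (T : SimpleGraph W) (hT : T.IsTree) :
    (T.Free H →
      (fun n : ℕ => (GenTuran.genExtremalNumber n H T : ℝ)) =Θ[Filter.atTop]
        (fun n : ℕ => (n : ℝ) ^ GenTuran.blowUpExponent H T)) ∧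
    (¬ T.Free H → ∀ n : ℕ, GenTuran.genExtremalNumber n H T = 0) := by
  classical
  refine ⟨fun hfree => ⟨?_, ?_⟩, fun hnot n => ?_⟩
  · obtain ⟨C, hC⟩ := GenTuran.exists_copyCount_le H hT
    refine Asymptotics.IsBigO.of_bound C ?_
    filter_upwards [Filter.eventually_gt_atTop 0] with n hn
    rw [Real.norm_of_nonneg (by positivity), Real.norm_of_nonneg (by positivity)]
    have : GenTuran.genExtremalNumber n H T ≤ C * n ^ GenTuran.blowUpExponent H T :=
      Finset.sup_le fun G hG => hC n hn G (by simpa using hG)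
    exact_mod_cast this
  · set k := Fintype.card V + 1 with hk
    -- The factor `2 * k` comes from `n ≤ 2 * k * (n / k)`, valid for `n ≥ k`, which absorbs the
    -- floor.
    refine Asymptotics.IsBigO.of_bound ((2 * k : ℝ) ^ GenTuran.blowUpExponent H T) ?_
    filter_upwards [Filter.eventually_ge_atTop k] with n hn
    rw [Real.norm_of_nonneg (by positivity), Real.norm_of_nonneg (by positivity)]
    have h1 := GenTuran.pow_le_genExtremalNumber hT hfree n hn
    have h2 : n ≤ 2 * k * (n / k) := by
      have hq : 1 ≤ n / k := (Nat.one_le_div_iff (by omega)).2 hn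
      have := Nat.div_add_mod n k
      have := Nat.mod_lt n (show 0 < k by omega)
      nlinarith
    have h3 : n ^ GenTuran.blowUpExponent H T ≤
        (2 * k) ^ GenTuran.blowUpExponent H T * GenTuran.genExtremalNumber n H T :=
      (Nat.pow_le_pow_left h2 _).trans (by rw [mul_pow]; gcongr)
    exact_mod_cast h3
  · refine Nat.le_zero.1 (Finset.sup_le fun G hG => Nat.le_zero.2 ?_)
    rw [SimpleGraph.copyCount_eq_zero]
    have hG : T.Free G := by simpa using hG
    exact fun h => hG ((SimpleGraph.not_free.1 hnot).trans h)
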